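/- Let $G$ be a finite simple graph with $n$ vertices and let $k\ge 0$ be an integer. A \emph{restraint} on $G$ is a function $r$ assigning to each vertex $v$ a finite set $r(v)$ of positive integers (forbidden colours). It is a \emph{$k$-restraint} if $|r(v)|=k$ and $r(v)\subseteq\{1,\dots,kn\}$ for every $v\in V(G)$, and it is \emph{proper} if $r(u)\cap r(v)=\emptyset$ for every edge $uv$ of $G$. For $x\in\mathbb N$ let $\pi_r(G,x)$ be the number of proper colourings $c:V(G)\to\{1,\dots,x\}$ with $c(v)\notin r(v)$ for every $v\in V(G)$. Let $R_{\max}(G,k)$ be the set of all $k$-restraints $r$ on $G$ such that, for all sufficiently large $x$, $\pi_{r}(G,x)\ge\pi_{r'}(G,x)$ for every $k$-restraint $r'$ on $G$. For an enumeration $V(G)=\{u_1,\dots,u_n\}$ put $$A_7''(G,r)=-\sum_{i=1}^n\ \sum_{\substack{u_j,u_l\in N_G(u_i)\\ j<l}}|r(u_j)\cap r(u_l)|.$$ \textbf{Theorem.} If $r^*\in R_{\max}(G,k)$, then (i) $r^*$ is a proper restraint; (ii) $A_7''(G,r^*)=\min\{A_7''(G,r): r \text{ is a proper } k\text{-restraint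 on } G\}$; in other words, $$\sum_{u\in V(G)}\ \sum_{\substack{v,w\in N_G(u)\\ v\ne w}}|r^*(v)\cap r^*(w)|\ \ge\ \sum_{u\in V(G)}\ \sum_{\substack{v,w\in N_G(u)\\ v\ne w}}|r(v)\cap r(w)|$$ for every proper $k$-restraint $r$ on $G$. -/

import Mathlib

/-- `r` is a `k`-restraint: every `r v` is a `k`-element subset of `{1, …, k * n}`, where `n` is the
order of the graph with vertex set `V`. A restraint is a function `V → Finset ℕ`. -/
def IsKRestraint {V : Type*} [Fintype V] (k : ℕ) (r : V → Finset ℕ) : Prop :=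
  ∀ v, (r v).card = k ∧ r v ⊆ Finset.Icc 1 (k * Fintype.card V)

/-- `r` is a proper restraint on `G`: adjacent vertices have disjoint sets of forbidden colours. -/
def IsProperRestraint {V : Type*} (G : SimpleGraph V) (r : V → Finset ℕ) : Prop :=
  ∀ u v, G.Adj u v → r u ∩ r v = ∅

/-- The number of proper colourings of `G` with colours in `{1, …, x}` that are permitted by `r`. -/
noncomputable def restrainedCount {V : Type*} (G : SimpleGraph V) (r : V → Finset ℕ) (x : ℕ) : ℕ :=
  Nat.card {c : G.Coloring (Set.Icc 1 x) // ∀ v, (c v : ℕ) ∉ r v}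

/-- `R_max(G, k)`: the `k`-restraints on `G` that permit, among all `k`-restraints on `G`, the
largest number of `x`-colourings for all large enough `x`. -/
def RMax {V : Type*} [Fintype V] (G : SimpleGraph V) (k : ℕ) : Set (V → Finset ℕ) :=
  {r | IsKRestraint k r ∧ ∃ X : ℕ, ∀ x ≥ X, ∀ r' : V → Finset ℕ, IsKRestraint k r' →
    restrainedCount G r' x ≤ restrainedCount G r x}

/-- `A₇''(G, r) = - ∑_{u} ∑_{u_j, u_k ∈ N(u), j < k} |r(u_j) ∩ r(u_k)|`, with respect to an
enumeration `e` of the vertices (`u_j = e j`). -/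
def A7'' {V : Type*} [Fintype V] (G : SimpleGraph V) [DecidableRel G.Adj]
    (e : Fin (Fintype.card V) ≃ V) (r : V → Finset ℕ) : ℤ :=
  -∑ i, ∑ j, ∑ k with G.Adj (e i) (e j) ∧ G.Adj (e i) (e k) ∧ j < k,
    ((r (e j) ∩ r (e k)).card : ℤ)

/-- `∑_{u} ∑_{v, w ∈ N(u), v ≠ w} |r(v) ∩ r(w)|`, over ordered pairs `(v, w)`. -/
def neighborOverlap {V : Type*} [Fintype V] [DecidableEq V] (G : SimpleGraph V)
    [DecidableRel G.Adj] (r : V → Finset ℕ) : ℕ :=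
  ∑ u, ∑ v ∈ G.neighborFinset u, ∑ w ∈ G.neighborFinset u with v ≠ w, (r v ∩ r w).card

/-!
Write `n` for the order of `G` and separate the colours up to `k * n`, which a `k`-restraint may
forbid, from the larger ones, which it never does. If `S` is the set of vertices that receive a
colour up to `k * n`, the number of ways to colour `S` depends on `r` but not on `x`, while the
number of ways to colour the complement of `S` does not depend on `r` and is asymptotic to
`x ^ (n - |S|)`. Hence, if another `k`-restraint allows as many colourings of every set `S` of size
less than `j` as a maximal one, it allows at most as many, in total, of the sets of size `j`.

For `|S| ≤ 1` the number of colourings is the same for all `k`-restraints. For `|S| = 2` it drops by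
`|r a ∩ r b|` if `S = {a, b}` is an edge; comparison with a restraint whose sets are pairwise
disjoint shows that a maximal restraint is proper. For `|S| = 3` and proper `r` it is a constant
plus `|r a ∩ r c|` for a cherry `a - b - c`, and a constant if `S` has a vertex isolated in `G[S]`.
So a maximal restraint maximises the sum of `|r a ∩ r c|` over all cherries.
-/

open Finset Filter Topology

section EraseSums

variable {α : Type*} [DecidableEq α]

theorem cast_card_erase (s : Finset α) (x : α) :
    ((s.erase x).card : ℤ) = s.card - if x ∈ s then 1 else 0 := by
  split_ifs with hx
  · exact cast_card_erase_of_mem hx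
  · rw [erase_eq_of_notMem hx, sub_zero]

theorem sum_card_erase (s t : Finset α) :
    ∑ x ∈ s, ((t.erase x).card : ℤ) = s.card * t.card - (s ∩ t).card := by
  simp only [cast_card_erase, sum_sub_distrib, sum_const, nsmul_eq_mul, sum_boole,
    filter_mem_eq_inter]

theorem sum_card_erase_mul_card_erase (s t u : Finset α) :
    ∑ x ∈ s, ((t.erase x).card : ℤ) * (u.erase x).card =
      s.card * t.card * u.card - (s ∩ t).card * u.card - (s ∩ u).card * t.card +
        (s ∩ (t ∩ u)).card := by
  have hterm (x : α) : ((t.erase x).card : ℤ) * (u.erase x).card = t.card * u.card -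
      (if x ∈ t then 1 else 0) * u.card - (if x ∈ u then 1 else 0) * t.card +
        if x ∈ t ∩ u then 1 else 0 := by
    rw [cast_card_erase, cast_card_erase]
    by_cases ht : x ∈ t <;> by_cases hu : x ∈ u <;> simp [ht, hu] <;> ring
  simp only [hterm, sum_add_distrib, sum_sub_distrib, ← sum_mul, sum_const, nsmul_eq_mul,
    sum_boole, filter_mem_eq_inter]

end EraseSums

section EraseAround

variable {V α : Type*} [DecidableEq α] (G : SimpleGraph V) [DecidableRel G.Adj]

/-- The lists left to the other vertices once the vertex `b` has received the colour `x`. -/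
def eraseAround (L : V → Finset α) (b : V) (x : α) : V → Finset α :=
  fun v => if G.Adj b v then (L v).erase x else L v

variable {G} {L L' : V → Finset α}

theorem eraseAround_union_of_forall_notMem {x : α} (hx : ∀ v, x ∉ L' v) (b : V) :
    eraseAround G (fun v => L v ∪ L' v) b x = fun v => eraseAround G L b x v ∪ L' v := by
  ext1 v
  by_cases h : G.Adj b v <;> simp [eraseAround, h, erase_union_distrib, erase_eq_of_notMem (hx v)]

theorem eraseAround_subset (b : V) (x : α) (v : V) : eraseAround G L b x v ⊆ L v := by
  rw [eraseAround]
  split_ifs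
  exacts [erase_subset x (L v), Subset.rfl]

end EraseAround

section ListColorings

variable {V α : Type*} [Fintype V] [DecidableEq V] [DecidableEq α] (G : SimpleGraph V)
  [DecidableRel G.Adj]

/-- The proper colourings of the induced subgraph `G[S]` in which every `v ∈ S` gets a colour from
the list `L v`. To keep all of them in the single type `V → α`, they are extended by `default`
outside `S`. -/
def listColorings [Inhabited α] (L : V → Finset α) (S : Finset V) : Finset (V → α) :=
  {c ∈ Fintype.piFinset fun v => if v ∈ S then L v else {default} |
    ∀ u ∈ S, ∀ v ∈ S, G.Adj u v → c u ≠ c v}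

variable {G} [Inhabited α] {L L' : V → Finset α} {S : Finset V}

theorem mem_listColorings {c : V → α} :
    c ∈ listColorings G L S ↔ (∀ v ∈ S, c v ∈ L v) ∧ (∀ v ∉ S, c v = default) ∧
      ∀ u ∈ S, ∀ v ∈ S, G.Adj u v → c u ≠ c v := by
  have hpi : (∀ v, c v ∈ if v ∈ S then L v else {default}) ↔
      (∀ v ∈ S, c v ∈ L v) ∧ ∀ v ∉ S, c v = default := by
    rw [← forall_and]
    refine forall_congr' fun v => ?_
    by_cases hv : v ∈ S <;> simp [hv]
  rw [listColorings, mem_filter, Fintype.mem_piFinset, hpi, and_assoc]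

theorem listColorings_congr (h : ∀ v ∈ S, L v = L' v) :
    listColorings G L S = listColorings G L' S := by
  ext c
  simp only [mem_listColorings]
  exact and_congr_left' (forall₂_congr fun v hv => by rw [h v hv])

theorem card_listColorings_empty : (listColorings G L ∅).card = 1 := by
  rw [card_eq_one]
  exact ⟨fun _ => default, ext fun c => by simp [mem_listColorings, funext_iff]⟩

theorem card_listColorings_insert {b : V} (hb : b ∉ S) :
    (listColorings G L (insert b S)).card =
      ∑ x ∈ L b, (listColorings G (eraseAround G L b x) S).card := by
  have hmaps : Set.MapsTo (fun c : V → α => c b) (listColorings G L (insert b S)) (L b) :=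
    fun c hc => (mem_listColorings.1 hc).1 b (mem_insert_self b S)
  rw [card_eq_sum_card_fiberwise hmaps]
  refine sum_congr rfl fun x hx => card_nbij' (fun c => Function.update c b default)
    (fun c => Function.update c b x) ?_ ?_ ?_ ?_
  · intro c hc
    simp only [coe_filter, Set.mem_ofPred_eq, mem_coe, mem_listColorings, eraseAround] at hc ⊢
    grind [G.adj_comm]
  · intro c hc
    simp only [coe_filter, Set.mem_ofPred_eq, mem_coe, mem_listColorings, eraseAround] at hc ⊢
    grind [G.adj_comm, G.irrefl]
  · intro c hc
    simp [← (mem_filter.1 hc).2]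
  · intro c hc
    simp [← (mem_listColorings.1 hc).2.1 b hb]

theorem card_listColorings_insert_of_forall_not_adj {b : V} (hb : b ∉ S)
    (hadj : ∀ v ∈ S, ¬G.Adj b v) :
    (listColorings G L (insert b S)).card = (L b).card * (listColorings G L S).card := by
  have hlists (x : α) : listColorings G (eraseAround G L b x) S = listColorings G L S :=
    listColorings_congr fun v hv => if_neg (hadj v hv)
  rw [card_listColorings_insert hb, sum_congr rfl fun x _ => by rw [hlists], sum_const, smul_eq_mul]

theorem card_listColorings_singleton (a : V) : (listColorings G L {a}).card = (L a).card := by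
  simpa [card_listColorings_empty] using
    card_listColorings_insert_of_forall_not_adj (G := G) (L := L) (notMem_empty a) (by simp)

theorem card_listColorings_le_pow {b : ℕ} (hL : ∀ v ∈ S, (L v).card ≤ b) :
    (listColorings G L S).card ≤ b ^ S.card := by
  calc (listColorings G L S).card
      ≤ ∏ v, (if v ∈ S then L v else {default}).card :=
        (card_filter_le _ _).trans_eq (Fintype.card_piFinset _)
    _ = ∏ v ∈ S, (L v).card := by simp [apply_ite card, prod_ite_mem]
    _ ≤ b ^ S.card := prod_le_pow_card _ _ _ hL

theorem descFactorial_le_card_listColorings {b : ℕ} (hL : ∀ v ∈ S, b ≤ (L v).card) :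
    b.descFactorial S.card ≤ (listColorings G L S).card := by
  induction S using Finset.induction_on generalizing L b with
  | empty => simp [card_listColorings_empty]
  | insert a S ha ih =>
    rw [card_insert_of_notMem ha, card_listColorings_insert ha]
    rcases b with _ | b
    · simp
    have hext (x : α) :
        b.descFactorial S.card ≤ (listColorings G (eraseAround G L a x) S).card := by
      refine ih fun v hv => ?_
      have hv' := hL v (mem_insert_of_mem hv)
      have herase := pred_card_le_card_erase (s := L v) (a := x)
      rw [eraseAround]
      split_ifs <;> omega
    calc (b + 1).descFactorial (S.card + 1)
        = (b + 1) * b.descFactorial S.card := Nat.succ_descFactorial_succ _ _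
      _ ≤ (L a).card * b.descFactorial S.card := by
        gcongr
        exact hL a (mem_insert_self a S)
      _ ≤ ∑ x ∈ L a, (listColorings G (eraseAround G L a x) S).card := by
        rw [← smul_eq_mul]
        exact card_nsmul_le_sum _ _ _ fun x _ => hext x

-- Induction on `S`: colouring the last vertex from either list leaves the other family unchanged.
theorem card_listColorings_union {A B : V → Finset α} (hAB : ∀ u v, Disjoint (A u) (B v))
    (S : Finset V) :
    (listColorings G (fun v => A v ∪ B v) S).card =
      ∑ T ∈ S.powerset, (listColorings G A T).card * (listColorings G B (S \ T)).card := by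
  induction S using Finset.induction_on generalizing A B with
  | empty => simp [card_listColorings_empty]
  | insert b S hb ih =>
    have hA : ∑ x ∈ A b, (listColorings G (eraseAround G (fun v => A v ∪ B v) b x) S).card =
        ∑ T ∈ S.powerset,
          (listColorings G A (insert b T)).card * (listColorings G B (S \ T)).card := by
      calc _ = ∑ x ∈ A b, ∑ T ∈ S.powerset, (listColorings G (eraseAround G A b x) T).card *
              (listColorings G B (S \ T)).card := sum_congr rfl fun x hx => by
            rw [eraseAround_union_of_forall_notMem fun v => disjoint_left.1 (hAB b v) hx]
            exact ih fun u v => (hAB u v).mono_left (eraseAround_subset b x u)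
        _ = _ := by
            rw [sum_comm]
            refine sum_congr rfl fun T hT => ?_
            rw [card_listColorings_insert fun h => hb (mem_powerset.1 hT h), sum_mul]
    have hB : ∑ x ∈ B b, (listColorings G (eraseAround G (fun v => A v ∪ B v) b x) S).card =
        ∑ T ∈ S.powerset,
          (listColorings G A T).card * (listColorings G B (insert b (S \ T))).card := by
      calc _ = ∑ x ∈ B b, ∑ T ∈ S.powerset, (listColorings G A T).card *
              (listColorings G (eraseAround G B b x) (S \ T)).card := sum_congr rfl fun x hx => by
            simp_rw [union_comm (A _)]
            rw [eraseAround_union_of_forall_notMem fun v => disjoint_right.1 (hAB v b) hx]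
            simp_rw [union_comm _ (A _)]
            exact ih fun u v => (hAB u v).mono_right (eraseAround_subset b x v)
        _ = _ := by
            rw [sum_comm]
            refine sum_congr rfl fun T _ => ?_
            rw [card_listColorings_insert fun h => hb (mem_sdiff.1 h).1, mul_sum]
    rw [card_listColorings_insert hb, sum_union (hAB b b), hA, hB, sum_powerset_insert hb, add_comm]
    congr 1
    · exact sum_congr rfl fun T hT => by
        rw [insert_sdiff_of_notMem _ fun h => hb (mem_powerset.1 hT h)]
    · exact sum_congr rfl fun T _ => by
        rw [insert_sdiff_insert, sdiff_insert_of_notMem hb]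

theorem card_listColorings_pair {a b : V} (hab : a ≠ b) :
    ((listColorings G L {a, b}).card : ℤ) =
      (L a).card * (L b).card - if G.Adj a b then ((L a ∩ L b).card : ℤ) else 0 := by
  by_cases hadj : G.Adj a b
  · rw [card_listColorings_insert (by simpa using hab), if_pos hadj, ← sum_card_erase]
    simp only [card_listColorings_singleton, eraseAround, if_pos hadj, Nat.cast_sum]
  · rw [card_listColorings_insert_of_forall_not_adj (by simpa using hab) (by simpa using hadj),
      card_listColorings_singleton, if_neg hadj, sub_zero, Nat.cast_mul]

theorem card_listColorings_congr_of_card_lt_three (hcard : ∀ v ∈ S, (L v).card = (L' v).card)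
    (hinter : ∀ u ∈ S, ∀ v ∈ S, G.Adj u v → (L u ∩ L v).card = (L' u ∩ L' v).card)
    (hS : S.card < 3) :
    (listColorings G L S).card = (listColorings G L' S).card := by
  obtain h | h | h : S.card = 0 ∨ S.card = 1 ∨ S.card = 2 := by omega
  · obtain rfl := card_eq_zero.1 h
    rw [card_listColorings_empty, card_listColorings_empty]
  · obtain ⟨a, rfl⟩ := card_eq_one.1 h
    rw [card_listColorings_singleton, card_listColorings_singleton, hcard a (mem_singleton_self a)]
  · obtain ⟨a, b, hab, rfl⟩ := card_eq_two.1 h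
    have ha : a ∈ ({a, b} : Finset V) := by simp
    have hb : b ∈ ({a, b} : Finset V) := by simp
    rw [← Nat.cast_inj (R := ℤ), card_listColorings_pair hab, card_listColorings_pair hab,
      hcard a ha, hcard b hb]
    split_ifs with hadj
    · rw [hinter a ha b hb hadj]
    · rfl

-- Colour the centre `b` first: the colour it takes is then removed from the lists of `a` and `c`.
theorem card_listColorings_triple_of_adj_of_adj {a b c : V} (hba : G.Adj b a) (hbc : G.Adj b c)
    (hac : a ≠ c) :
    ((listColorings G L {b, a, c}).card : ℤ) =
      (L a).card * (L b).card * (L c).card - (L b ∩ L a).card * (L c).card -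
        (L b ∩ L c).card * (L a).card + (L b ∩ (L a ∩ L c)).card -
        if G.Adj a c then (L b).card * (L a ∩ L c).card - ((L b ∩ (L a ∩ L c)).card : ℤ)
        else 0 := by
  have hb : b ∉ ({a, c} : Finset V) := by simp [hba.ne, hbc.ne]
  have hpair (x : α) : ((listColorings G (eraseAround G L b x) {a, c}).card : ℤ) =
      ((L a).erase x).card * ((L c).erase x).card -
        if G.Adj a c then (((L a ∩ L c).erase x).card : ℤ) else 0 := by
    rw [card_listColorings_pair hac]
    simp only [eraseAround, if_pos hba, if_pos hbc, erase_inter, inter_erase, erase_idem]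
  rw [card_listColorings_insert hb, Nat.cast_sum, sum_congr rfl fun x _ => hpair x,
    sum_sub_distrib, sum_card_erase_mul_card_erase, sum_ite_irrel, sum_card_erase, sum_const_zero]
  ring

end ListColorings

section Asymptotics

theorem sum_leading_coeff_nonneg {ι : Type*} {s : Finset ι} {P : ι → ℕ → ℝ} {d : ι → ℕ}
    (hP : ∀ i ∈ s, Tendsto (fun x : ℕ => P i x / (x : ℝ) ^ d i) atTop (𝓝 1)) {a : ι → ℝ} {D : ℕ}
    (ha : ∀ i ∈ s, D < d i → a i = 0) (hpos : ∀ᶠ x in atTop, 0 ≤ ∑ i ∈ s, a i * P i x) :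
    0 ≤ ∑ i ∈ s with d i = D, a i := by
  have hterm (i) (hi : i ∈ s) : Tendsto (fun x : ℕ => a i * P i x / (x : ℝ) ^ D) atTop
      (𝓝 (if d i = D then a i else 0)) := by
    rcases lt_trichotomy (d i) D with hlt | rfl | hgt
    · have hratio : Tendsto (fun x : ℕ => (x : ℝ) ^ d i / (x : ℝ) ^ D) atTop (𝓝 0) :=
        (tendsto_pow_div_pow_atTop_zero hlt).comp tendsto_natCast_atTop_atTop
      have hprod := ((hP i hi).mul hratio).const_mul (a i)
      rw [mul_zero, mul_zero] at hprod
      rw [if_neg hlt.ne]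
      refine hprod.congr' ?_
      filter_upwards [eventually_ne_atTop 0] with x hx
      field_simp
    · simpa [mul_div_assoc] using (hP i hi).const_mul (a i)
    · simp [ha i hi hgt]
  rw [sum_filter]
  refine ge_of_tendsto (tendsto_finsetSum s hterm) ?_
  filter_upwards [hpos] with x hx
  rw [← sum_div]
  positivity

variable {V α : Type*} [Fintype V] [DecidableEq V] [DecidableEq α] [Inhabited α]

theorem tendsto_card_listColorings_div_pow (G : SimpleGraph V) [DecidableRel G.Adj]
    {L : ℕ → V → Finset α} (hL : ∀ x v, (L x v).card = x) (S : Finset V) :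
    Tendsto (fun x : ℕ => ((listColorings G (L x) S).card : ℝ) / (x : ℝ) ^ S.card) atTop
      (𝓝 1) := by
  have hdesc : Tendsto (fun x : ℕ => (x.descFactorial S.card : ℝ) / (x : ℝ) ^ S.card) atTop
      (𝓝 1) := by
    refine (Asymptotics.isEquivalent_iff_tendsto_one ?_).1 (isEquivalent_descFactorial S.card)
    filter_upwards [eventually_ne_atTop 0] with x hx
    positivity
  refine tendsto_of_tendsto_of_tendsto_of_le_of_le hdesc tendsto_const_nhds ?_ ?_
  · intro x
    dsimp only
    gcongr
    exact descFactorial_le_card_listColorings fun v _ => (hL x v).ge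
  · intro x
    refine div_le_one_of_le₀ ?_ (by positivity)
    rw [← Nat.cast_pow, Nat.cast_le]
    exact card_listColorings_le_pow fun v _ => (hL x v).le

end Asymptotics

section HeadCount

variable {V : Type*} [Fintype V]

/-- The colours of `{1, …, k * n}` that the restraint `r` permits at `v`. All colours beyond
`k * n` are permitted by every `k`-restraint. -/
def permittedColors (k : ℕ) (r : V → Finset ℕ) (v : V) : Finset ℕ :=
  Icc 1 (k * Fintype.card V) \ r v

variable {k : ℕ} {r : V → Finset ℕ}

namespace IsKRestraint

theorem card_permittedColors (hr : IsKRestraint k r) (v : V) :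
    ((permittedColors k r v).card : ℤ) = k * Fintype.card V - k := by
  rw [permittedColors, cast_card_sdiff (hr v).2, Nat.card_Icc, (hr v).1]
  push_cast
  ring

theorem card_permittedColors_inter (hr : IsKRestraint k r) (u v : V) :
    ((permittedColors k r u ∩ permittedColors k r v).card : ℤ) =
      k * Fintype.card V - 2 * k + (r u ∩ r v).card := by
  have hunion := card_union_add_card_inter (r u) (r v)
  rw [(hr u).1, (hr v).1] at hunion
  rw [permittedColors, permittedColors, ← sdiff_union_distrib,
    cast_card_sdiff (union_subset (hr u).2 (hr v).2), Nat.card_Icc]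
  push_cast
  linarith

theorem card_permittedColors_inter_inter (hr : IsKRestraint k r) {a b c : V}
    (hba : r b ∩ r a = ∅) (hbc : r b ∩ r c = ∅) :
    ((permittedColors k r b ∩ (permittedColors k r a ∩ permittedColors k r c)).card : ℤ) =
      k * Fintype.card V - 3 * k + (r a ∩ r c).card := by
  have hunion_ac := card_union_add_card_inter (r a) (r c)
  have hunion := card_union_add_card_inter (r b) (r a ∪ r c)
  rw [inter_union_distrib_left, hba, hbc, union_empty, card_empty, (hr b).1] at hunion
  rw [(hr a).1, (hr c).1] at hunion_ac
  simp only [permittedColors, ← sdiff_union_distrib]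
  rw [cast_card_sdiff (union_subset (hr b).2 (union_subset (hr a).2 (hr c).2)), Nat.card_Icc]
  push_cast
  linarith

end IsKRestraint

theorem exists_isKRestraint_pairwise_disjoint (V : Type*) [Fintype V] (k : ℕ) :
    ∃ r : V → Finset ℕ, IsKRestraint k r ∧ Pairwise (Function.onFun Disjoint r) := by
  let e := Fintype.equivFin V
  refine ⟨fun v => Ioc (k * e v) (k * (e v + 1)), fun v => ⟨?_, ?_⟩, fun u v huv => ?_⟩
  · rw [Nat.card_Ioc, mul_add_one, Nat.add_sub_cancel_left]
  · refine fun x hx => mem_Icc.2 ⟨Nat.one_le_of_lt (mem_Ioc.1 hx).1, (mem_Ioc.1 hx).2.trans ?_⟩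
    exact Nat.mul_le_mul_left k (e v).isLt
  · have hmono : Monotone fun i : ℕ => k * i := fun i j hij => Nat.mul_le_mul_left k hij
    have hne : (e u : ℕ) ≠ e v := fun h => huv (e.injective (Fin.ext h))
    have hdisj := hmono.pairwise_disjoint_on_Ioc_succ hne
    simpa [Function.onFun, ← disjoint_coe] using hdisj

variable [DecidableEq V] (G : SimpleGraph V) [DecidableRel G.Adj]

/-- The number of proper colourings of `G[S]` with colours in `{1, …, k * n}` permitted by `r`. -/
def headCount (k : ℕ) (r : V → Finset ℕ) (S : Finset V) : ℕ :=
  (listColorings G (permittedColors k r) S).card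

theorem restrainedCount_eq_card_listColorings (r : V → Finset ℕ) (x : ℕ) :
    restrainedCount G r x = (listColorings G (fun v => Icc 1 x \ r v) univ).card := by
  have hmem {c : V → ℕ} : c ∈ listColorings G (fun v => Icc 1 x \ r v) univ ↔
      (∀ v, c v ∈ Set.Icc 1 x ∧ c v ∉ r v) ∧ ∀ u v, G.Adj u v → c u ≠ c v := by
    simp [mem_listColorings]
  rw [restrainedCount, ← Nat.card_eq_finsetCard]
  exact Nat.card_congr
    { toFun := fun c => ⟨fun v => (c.1 v : ℕ), hmem.2 ⟨fun v => ⟨(c.1 v).2, c.2 v⟩,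
        fun u v huv h => c.1.valid huv (Subtype.ext h)⟩⟩
      invFun := fun c =>
        ⟨SimpleGraph.Coloring.mk (fun v => ⟨c.1 v, ((hmem.1 c.2).1 v).1⟩)
          fun huv h => (hmem.1 c.2).2 _ _ huv (congrArg Subtype.val h),
          fun v => ((hmem.1 c.2).1 v).2⟩
      left_inv := fun _ => rfl
      right_inv := fun _ => rfl }

variable {G}

theorem IsKRestraint.restrainedCount_add (hr : IsKRestraint k r) (x : ℕ) :
    restrainedCount G r (k * Fintype.card V + x) = ∑ S, headCount G k r S *
      (listColorings G (fun _ => Ioc (k * Fintype.card V) (k * Fintype.card V + x)) Sᶜ).card := by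
  set N := k * Fintype.card V
  have hsplit : (fun v => Icc 1 (N + x) \ r v) =
      fun v => permittedColors k r v ∪ Ioc N (N + x) := by
    ext v i
    have hi : i ∈ r v → 1 ≤ i ∧ i ≤ N := fun h => mem_Icc.1 ((hr v).2 h)
    grind [permittedColors]
  have hdisj (u _v : V) : Disjoint (permittedColors k r u) (Ioc N (N + x)) := by
    refine disjoint_left.2 fun i hi hi' => ?_
    exact (mem_Ioc.1 hi').1.not_ge (mem_Icc.1 (mem_sdiff.1 hi).1).2
  rw [restrainedCount_eq_card_listColorings, hsplit, card_listColorings_union hdisj, powerset_univ]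
  rfl

theorem sum_headCount_le_of_mem_RMax {rstar : V → Finset ℕ} (hstar : rstar ∈ RMax G k)
    (hr : IsKRestraint k r) {j : ℕ}
    (heq : ∀ S : Finset V, S.card < j → headCount G k r S = headCount G k rstar S) :
    ∑ S ∈ powersetCard j univ, headCount G k r S ≤
      ∑ S ∈ powersetCard j univ, headCount G k rstar S := by
  obtain ⟨hkstar, X, hX⟩ := hstar
  obtain hj | hj := lt_or_ge (Fintype.card V) j
  · rw [powersetCard_eq_empty.2 hj, sum_empty, sum_empty]
  set N := k * Fintype.card V
  have hcompl (S : Finset V) : Sᶜ.card + S.card = Fintype.card V := card_compl_add_card S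
  have hdiff := sum_leading_coeff_nonneg (s := univ) (D := Fintype.card V - j)
    (a := fun S => (headCount G k rstar S : ℝ) - headCount G k r S)
    (fun S _ => tendsto_card_listColorings_div_pow G (L := fun x _ => Ioc N (N + x)) (by simp) Sᶜ)
    (fun S _ hS => by rw [heq S (by have := hcompl S; omega), sub_self])
    (by
      filter_upwards [eventually_ge_atTop X] with x hx
      have hle := hX (N + x) (by omega) r hr
      rw [hr.restrainedCount_add, hkstar.restrainedCount_add] at hle
      simp only [sub_mul, sum_sub_distrib, sub_nonneg]
      exact_mod_cast hle)
  have hfilter : ({S : Finset V | Sᶜ.card = Fintype.card V - j} : Finset (Finset V)) =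
      powersetCard j univ := by
    ext S
    have := hcompl S
    simp only [mem_filter_univ, mem_powersetCard_univ]
    omega
  rw [hfilter, sum_sub_distrib, sub_nonneg] at hdiff
  exact_mod_cast hdiff

end HeadCount

section Overlap

theorem exists_isolated_or_exists_cherry {V : Type*} [DecidableEq V] (G : SimpleGraph V)
    {S : Finset V} (hS : S.card = 3) :
    (∃ b T, b ∉ T ∧ (∀ v ∈ T, ¬G.Adj b v) ∧ insert b T = S) ∨
      ∃ a b c, G.Adj b a ∧ G.Adj b c ∧ a ≠ c ∧ {b, a, c} = S := by
  obtain ⟨x, y, z, hxy, hxz, hyz, rfl⟩ := card_eq_three.1 hS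
  have hyxz : ({y, x, z} : Finset V) = {x, y, z} := insert_comm y x {z}
  have hzxy : ({z, x, y} : Finset V) = {x, y, z} := by rw [insert_comm, pair_comm z, insert_comm]
  by_cases hadj : G.Adj x y <;> by_cases hadj' : G.Adj x z
  · exact .inr ⟨y, x, z, hadj, hadj', hyz, rfl⟩
  · by_cases hadj'' : G.Adj y z
    · exact .inr ⟨x, y, z, hadj.symm, hadj'', hxz, hyxz⟩
    · exact .inl ⟨z, {x, y}, by simp [hxz.symm, hyz.symm],
        by simp [G.adj_comm z, hadj', hadj''], hzxy⟩
  · by_cases hadj'' : G.Adj y z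
    · exact .inr ⟨x, z, y, hadj'.symm, hadj''.symm, hxy, hzxy⟩
    · exact .inl ⟨y, {x, z}, by simp [hxy.symm, hyz], by simp [G.adj_comm y x, hadj, hadj''], hyxz⟩
  · exact .inl ⟨x, {y, z}, by simp [hxy, hxz], by simp [hadj, hadj'], rfl⟩

theorem two_mul_sum_sum_lt {ι R : Type*} [Fintype ι] [LinearOrder ι] [NonAssocSemiring R]
    {f : ι → ι → R} (hf : ∀ i j, f i j = f j i) :
    2 * ∑ i, ∑ j with i < j, f i j = ∑ i, ∑ j with i ≠ j, f i j := by
  have hswap : ∑ i, ∑ j, (if i < j then f i j else 0) = ∑ i, ∑ j, if j < i then f i j else 0 := by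
    rw [sum_comm]
    simp only [hf]
  simp only [sum_filter]
  rw [two_mul]
  nth_rewrite 2 [hswap]
  simp only [← sum_add_distrib]
  refine sum_congr rfl fun i _ => sum_congr rfl fun j _ => ?_
  rcases lt_trichotomy i j with h | rfl | h
  · simp [h, h.ne, h.not_gt]
  · simp
  · simp [h, h.ne', h.not_gt]

variable {V : Type*} [Fintype V] [DecidableEq V] (G : SimpleGraph V) [DecidableRel G.Adj]

theorem neighborOverlap_eq_sum_ite (r : V → Finset ℕ) :
    neighborOverlap G r = ∑ u, ∑ v, ∑ w with v ≠ w,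
      if G.Adj u v ∧ G.Adj u w then (r v ∩ r w).card else 0 := by
  refine sum_congr rfl fun u _ => ?_
  rw [SimpleGraph.neighborFinset_eq_filter, sum_filter]
  refine sum_congr rfl fun v _ => ?_
  by_cases h : G.Adj u v
  · simp only [h, if_true, true_and]
    rw [filter_filter, sum_filter, sum_filter]
    simp only [← ite_and, and_comm]
  · simp [h]

theorem two_mul_A7'' (e : Fin (Fintype.card V) ≃ V) (r : V → Finset ℕ) :
    2 * A7'' G e r = -neighborOverlap G r := by
  let f (i j l : Fin (Fintype.card V)) : ℤ :=
    if G.Adj (e i) (e j) ∧ G.Adj (e i) (e l) then ((r (e j) ∩ r (e l)).card : ℤ) else 0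
  have hA7'' : A7'' G e r = -∑ i, ∑ j, ∑ l with j < l, f i j l := by
    simp only [A7'', f, ← sum_filter, filter_filter, and_comm, and_left_comm]
  have hoverlap : (neighborOverlap G r : ℤ) = ∑ i, ∑ j, ∑ l with j ≠ l, f i j l := by
    simp only [neighborOverlap_eq_sum_ite, f, ← e.sum_comp, sum_filter, e.injective.ne_iff]
    push_cast
    rfl
  have hsymm (i j l) : f i j l = f i l j := by
    simp only [f, and_comm, inter_comm]
  rw [hA7'', hoverlap, mul_neg, mul_sum]
  simp only [two_mul_sum_sum_lt (hsymm _)]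

/-- The cherries `(u, v, w)` of `G`: the paths `v - u - w` with centre `u`. Each path occurs twice,
once for either order of its ends. -/
def cherries : Finset (V × V × V) :=
  {t | G.Adj t.1 t.2.1 ∧ G.Adj t.1 t.2.2 ∧ t.2.1 ≠ t.2.2}

/-- The part of `neighborOverlap G r` contributed by the cherries with vertex set `S`. -/
def overlapOn (r : V → Finset ℕ) (S : Finset V) : ℕ :=
  ∑ t ∈ cherries G with {t.1, t.2.1, t.2.2} = S, (r t.2.1 ∩ r t.2.2).card

theorem neighborOverlap_eq_sum_cherries (r : V → Finset ℕ) :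
    neighborOverlap G r = ∑ t ∈ cherries G, (r t.2.1 ∩ r t.2.2).card := by
  simp only [neighborOverlap_eq_sum_ite, cherries, sum_filter, Fintype.sum_prod_type, ← ite_and,
    and_comm, and_left_comm]

theorem sum_overlapOn (r : V → Finset ℕ) :
    ∑ S ∈ powersetCard 3 univ, overlapOn G r S = neighborOverlap G r := by
  rw [neighborOverlap_eq_sum_cherries]
  refine sum_fiberwise_of_maps_to (fun t ht => ?_) _
  obtain ⟨huv, huw, hvw⟩ := mem_filter_univ _ |>.1 ht
  exact mem_powersetCard_univ.2 (card_eq_three.2 ⟨_, _, _, huv.ne, huw.ne, hvw, rfl⟩)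

variable {G} {r : V → Finset ℕ}

theorem overlapOn_insert_of_forall_not_adj {b : V} {S : Finset V} (hadj : ∀ v ∈ S, ¬G.Adj b v) :
    overlapOn G r (insert b S) = 0 := by
  refine sum_eq_zero fun ⟨u, v, w⟩ ht => ?_
  obtain ⟨ht, hsupport⟩ := mem_filter.1 ht
  obtain ⟨huv, huw, hvw⟩ := mem_filter_univ _ |>.1 ht
  have hb_nbr (x : V) (hx : x ∈ ({u, v, w} : Finset V)) : ¬G.Adj b x := fun hbx =>
    hadj x (mem_of_mem_insert_of_ne (hsupport ▸ hx) hbx.ne') hbx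
  have hb_mem : b ∈ ({u, v, w} : Finset V) := hsupport ▸ mem_insert_self b S
  simp only [mem_insert, mem_singleton] at hb_mem
  obtain rfl | rfl | rfl := hb_mem
  · exact (hb_nbr v (by simp) huv).elim
  · exact (hb_nbr u (by simp) huv.symm).elim
  · exact (hb_nbr u (by simp) huw.symm).elim

theorem IsProperRestraint.overlapOn_of_adj_of_adj (hp : IsProperRestraint G r) {a b c : V}
    (hba : G.Adj b a) (hbc : G.Adj b c) (hac : a ≠ c) :
    overlapOn G r {b, a, c} = 2 * (r a ∩ r c).card := by
  have hne : (b, a, c) ≠ (b, c, a) := by simp [hac]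
  rw [overlapOn, ← sum_subset (s₁ := {(b, a, c), (b, c, a)}), sum_pair hne, inter_comm (r c),
    two_mul]
  · simp only [insert_subset_iff, singleton_subset_iff, mem_filter, cherries]
    grind
  · rintro ⟨u, v, w⟩ ht hnot
    obtain ⟨ht, hsupport⟩ := mem_filter.1 ht
    obtain ⟨huv, huw, hvw⟩ := mem_filter_univ _ |>.1 ht
    have hmem (x : V) (hx : x ∈ ({u, v, w} : Finset V)) : x = b ∨ x = a ∨ x = c := by
      simpa using (hsupport ▸ hx : x ∈ ({b, a, c} : Finset V))
    have hcenter (x : V) (hx : x ∈ ({u, v, w} : Finset V)) (hxb : x ≠ b) : G.Adj b x := by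
      obtain rfl | rfl | rfl := hmem x hx
      exacts [absurd rfl hxb, hba, hbc]
    have hb_mem : b ∈ ({u, v, w} : Finset V) := hsupport ▸ mem_insert_self b _
    have hbu : b ≠ u := by
      rintro rfl
      have hv := hmem v (by simp)
      have hw := hmem w (by simp)
      grind [huv.ne, huw.ne]
    have hadj : G.Adj v w := by
      simp only [mem_insert, mem_singleton, hbu, false_or] at hb_mem
      obtain rfl | rfl := hb_mem
      · exact hcenter w (by simp) hvw.symm
      · exact (hcenter v (by simp) hvw).symm
    rw [hp v w hadj, card_empty]

end Overlap

section TripleComparison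

variable {V : Type*} [Fintype V] [DecidableEq V] {G : SimpleGraph V} [DecidableRel G.Adj] {k : ℕ}
  {r r' : V → Finset ℕ}

theorem headCount_congr_of_card_lt_three (hr : IsKRestraint k r) (hr' : IsKRestraint k r')
    {S : Finset V} (hS : S.card < 3)
    (hinter : ∀ u ∈ S, ∀ v ∈ S, G.Adj u v → (r u ∩ r v).card = (r' u ∩ r' v).card) :
    headCount G k r S = headCount G k r' S := by
  refine card_listColorings_congr_of_card_lt_three (fun v _ => ?_) (fun u hu v hv huv => ?_) hS
  · rw [← Nat.cast_inj (R := ℤ), hr.card_permittedColors, hr'.card_permittedColors]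
  · rw [← Nat.cast_inj (R := ℤ), hr.card_permittedColors_inter, hr'.card_permittedColors_inter,
      hinter u hu v hv huv]

theorem IsKRestraint.headCount_pair (hr : IsKRestraint k r) {a b : V} (hab : a ≠ b) :
    (headCount G k r {a, b} : ℤ) = (k * Fintype.card V - k) ^ 2 -
      if G.Adj a b then (k * Fintype.card V - 2 * k + (r a ∩ r b).card : ℤ) else 0 := by
  rw [headCount, card_listColorings_pair hab, hr.card_permittedColors,
    hr.card_permittedColors, hr.card_permittedColors_inter, sq]

theorem IsKRestraint.headCount_cherry (hr : IsKRestraint k r) (hp : IsProperRestraint G r)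
    {a b c : V} (hba : G.Adj b a) (hbc : G.Adj b c) (hac : a ≠ c) :
    (headCount G k r {b, a, c} : ℤ) = (k * Fintype.card V - k) ^ 3 -
        2 * (k * Fintype.card V - k) * (k * Fintype.card V - 2 * k) +
        (k * Fintype.card V - 3 * k) + (r a ∩ r c).card -
      if G.Adj a c then ((k * Fintype.card V - k) * (k * Fintype.card V - 2 * k) -
        (k * Fintype.card V - 3 * k) : ℤ) else 0 := by
  have hinter : G.Adj a c → ((r a ∩ r c).card : ℤ) = 0 := fun h => by rw [hp a c h]; simp
  rw [headCount, card_listColorings_triple_of_adj_of_adj hba hbc hac]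
  simp only [hr.card_permittedColors, hr.card_permittedColors_inter,
    hr.card_permittedColors_inter_inter (hp b a hba) (hp b c hbc), hp b a hba, hp b c hbc]
  split_ifs with h
  · rw [hinter h]
    simp
    ring
  · simp
    ring

theorem two_mul_headCount_add_overlapOn (hr : IsKRestraint k r) (hp : IsProperRestraint G r)
    (hr' : IsKRestraint k r') (hp' : IsProperRestraint G r') {S : Finset V} (hS : S.card = 3) :
    2 * headCount G k r S + overlapOn G r' S = 2 * headCount G k r' S + overlapOn G r S := by
  obtain ⟨b, T, hb, hadj, rfl⟩ | ⟨a, b, c, hba, hbc, hac, rfl⟩ :=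
    exists_isolated_or_exists_cherry G hS
  · have hT : T.card < 3 := by
      rw [card_insert_of_notMem hb] at hS
      omega
    have hcard : (permittedColors k r b).card = (permittedColors k r' b).card := by
      rw [← Nat.cast_inj (R := ℤ), hr.card_permittedColors, hr'.card_permittedColors]
    have hhead : headCount G k r (insert b T) = headCount G k r' (insert b T) := by
      rw [headCount, headCount, card_listColorings_insert_of_forall_not_adj hb hadj,
        card_listColorings_insert_of_forall_not_adj hb hadj, hcard, ← headCount, ← headCount,
        headCount_congr_of_card_lt_three hr hr' hT fun u _ v _ huv => by
          rw [hp u v huv, hp' u v huv]]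
    rw [overlapOn_insert_of_forall_not_adj hadj, overlapOn_insert_of_forall_not_adj hadj,
      hhead]
  · rw [hp.overlapOn_of_adj_of_adj hba hbc hac, hp'.overlapOn_of_adj_of_adj hba hbc hac]
    have hhead := hr.headCount_cherry hp hba hbc hac
    have hhead' := hr'.headCount_cherry hp' hba hbc hac
    omega

end TripleComparison

section Maximal

variable {V : Type*} [Fintype V] {G : SimpleGraph V} {k : ℕ} {rstar r : V → Finset ℕ}

theorem isProperRestraint_of_mem_RMax (hstar : rstar ∈ RMax G k) : IsProperRestraint G rstar := by
  classical
  obtain ⟨r₀, hr₀, hdisj⟩ := exists_isKRestraint_pairwise_disjoint V k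
  have hempty {a b : V} (hab : a ≠ b) : r₀ a ∩ r₀ b = ∅ :=
    disjoint_iff_inter_eq_empty.1 (hdisj hab)
  have hsum := sum_headCount_le_of_mem_RMax hstar hr₀ (j := 2) fun S hS =>
    headCount_congr_of_card_lt_three hr₀ hstar.1 (by omega) fun u hu v hv huv =>
      absurd (card_le_one.1 (Nat.lt_succ_iff.1 hS) u hu v hv) huv.ne
  have hle : ∀ S ∈ powersetCard 2 univ, headCount G k rstar S ≤ headCount G k r₀ S := by
    intro S hS
    obtain ⟨a, b, hab, rfl⟩ := card_eq_two.1 (mem_powersetCard_univ.1 hS)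
    rw [← Nat.cast_le (α := ℤ), hr₀.headCount_pair hab, hstar.1.headCount_pair hab, hempty hab]
    split_ifs
    · rw [card_empty, Nat.cast_zero]
      linarith [Nat.cast_nonneg (α := ℤ) (rstar a ∩ rstar b).card]
    · exact le_rfl
  have heq := (sum_eq_sum_iff_of_le hle).1 ((sum_le_sum hle).antisymm hsum)
  intro a b hadj
  have hhead := heq {a, b} (mem_powersetCard_univ.2 (card_pair hadj.ne))
  rw [← Nat.cast_inj (R := ℤ), hr₀.headCount_pair hadj.ne, hstar.1.headCount_pair hadj.ne,
    hempty hadj.ne] at hhead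
  simpa [hadj] using hhead

theorem neighborOverlap_le_of_mem_RMax [DecidableEq V] [DecidableRel G.Adj]
    (hstar : rstar ∈ RMax G k) (hr : IsKRestraint k r) (hp : IsProperRestraint G r) :
    neighborOverlap G r ≤ neighborOverlap G rstar := by
  have hpstar := isProperRestraint_of_mem_RMax hstar
  have hhead := sum_headCount_le_of_mem_RMax hstar hr (j := 3) fun S hS =>
    headCount_congr_of_card_lt_three hr hstar.1 hS fun u _ v _ huv => by
      rw [hp u v huv, hpstar u v huv]
  have hbalance := sum_congr rfl fun S hS =>
    two_mul_headCount_add_overlapOn hr hp hstar.1 hpstar (mem_powersetCard_univ.1 hS)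
  simp only [sum_add_distrib, ← mul_sum, sum_overlapOn] at hbalance
  omega

end Maximal

theorem mainTheorem5 {V : Type*} [Fintype V] [DecidableEq V] (G : SimpleGraph V)
    [DecidableRel G.Adj] (k : ℕ) (rstar : V → Finset ℕ) (hr : rstar ∈ RMax G k) :
    IsProperRestraint G rstar ∧
    (∀ e : Fin (Fintype.card V) ≃ V,
      IsLeast {a : ℤ | ∃ r : V → Finset ℕ,
        IsKRestraint k r ∧ IsProperRestraint G r ∧ a = A7'' G e r} (A7'' G e rstar)) ∧
    (∀ r : V → Finset ℕ, IsKRestraint k r → IsProperRestraint G r →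
      neighborOverlap G r ≤ neighborOverlap G rstar) := by
  have hproper := isProperRestraint_of_mem_RMax hr
  refine ⟨hproper, fun e => ⟨⟨rstar, hr.1, hproper, rfl⟩, ?_⟩,
    fun r hk hp => neighborOverlap_le_of_mem_RMax hr hk hp⟩
  rintro _ ⟨r, hk, hp, rfl⟩
  have hoverlap := neighborOverlap_le_of_mem_RMax hr hk hp
  have hA7''star := two_mul_A7'' G e rstar
  have hA7'' := two_mul_A7'' G e r
  omega
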